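/- **Theorem (Quantum hypergraph soft covering).** Let $\mathcal V$ be a finite-dimensional complex Hilbert space, $\mathcal X$ a finite set, $p$ a probability distribution on $\mathcal X$, and $(E_x)_{x\in\mathcal X}$ Hermitian matrices on $\mathcal V$ (edges) with $E_x\succeq 0$ and $\mathrm{Tr}(E_x)\le 1$ (so in particular $0\preceq E_x\preceq \mathbf 1_{\mathcal V}$). Put $E_p=\sum_x p(x)E_x$ and, for a codebook $\mathcal C=(x_1,\dots,x_L)\in\mathcal X^L$, $E_{\mathcal C}=\frac1L\sum_{l=1}^L E_{x_l}$. Let $\varepsilon,\tau\in(0,\frac12)$, $\tau_0\in(0,\frac12-\tau)$, $\eta>0$, and assume $E_x\preceq\eta\mathbf 1_{\mathcal V}$ for all $x$ and $\mathrm{Tr}(E_p)\ge 1-\tau$. Let $\Pi_1$ be the orthogonal projector onto the sum of the eigenspaces of $E_p$ with eigenvalue $>\tau_0/\dim\mathcal V$, and write $A^{\Pi_1}=\Pi_1A\Pi_1$. With the generalized inverse square root $(E_p^{\Pi_1})^{-1/2}$ (which vanishes on the kernel), define $$D_{\max}=\max_x\ln\lambda_{\max}\big((E_p^{\Pi_1})^{-1/2}E_x^{\Pi_1}(E_p^{\Pi_1})^{-1/2}\big),\qquad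 M(x)=e^{-D_{\max}}(E_p^{\Pi_1})^{-1/2}E_x^{\Pi_1}(E_p^{\Pi_1})^{-1/2}.$$ The matrix multiplicative weight update (MMWU) algorithm, run on $\mathrm{supp}(E_p^{\Pi_1})$, chooses $x_1,\dots,x_L$ as follows: in round $l=1,\dots,L$ it sets $G(l)=\exp\big(-\varepsilon\sum_{l'<l}M(x_{l'})\big)$ (an operator on $\mathrm{supp}(E_p^{\Pi_1})$, with $G(1)$ the identity there) and $F(l)=G(l)/\mathrm{Tr}(G(l))$, and it takes for $x_l$ any maximizer of $x\mapsto\mathrm{Tr}(F(l)M(x))$ over $\mathcal X$. Then for every integer $L\ge1$ with $$L\ \ge\ \frac{\eta\,\dim(\mathcal V)\,\ln\dim(\mathcal V)}{\varepsilon^2\tau_0}$$ the algorithm yields a codebook of size $L$, and every codebook $\mathcal C=(x_1,\dots,x_L)$ obtained by it (however ties are broken) satisfies $$d_{\mathrm{tr}}(E_p,E_{\mathcal C})=\tfrac12\|E_p-E_{\mathcal C}\|_1\ \le\ 3\varepsilon+3\tau+\tfrac72\tau_0+\sqrt{2\varepsilon+\tau+\tau_0}.$$ -/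

import Mathlib

open scoped Matrix ComplexOrder

noncomputable section

namespace SoftCovering

variable {ι X : Type*} [Fintype ι] [DecidableEq ι]

/-- Trace norm `‖A‖₁ = Tr √(A* A)`. -/
def traceNorm (A : Matrix ι ι ℂ) : ℝ :=
  (cfc Real.sqrt (Aᴴ * A)).trace.re

/-- Trace distance `½ ‖A - B‖₁`. -/
def traceDist (A B : Matrix ι ι ℂ) : ℝ :=
  (1 / 2) * traceNorm (A - B)

/-- The `p`-average `E_p = ∑ₓ p(x) E_x`. -/
def avg [Fintype X] (p : X → ℝ) (E : X → Matrix ι ι ℂ) : Matrix ι ι ℂ :=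
  ∑ x, p x • E x

/-- The uniform average `E_C = (1/L) ∑ₗ E_{x_l}` over a codebook `x_1, …, x_L`. -/
def codebookAvg {L : ℕ} (E : X → Matrix ι ι ℂ) (x : Fin L → X) : Matrix ι ι ℂ :=
  (1 / (L : ℝ)) • ∑ l, E (x l)

/-- The spectral projector `{A > r}` of a Hermitian matrix `A`: the sum of the eigenprojectors
of `A` that belong to eigenvalues larger than `r`. -/
def projGT (A : Matrix ι ι ℂ) (r : ℝ) : Matrix ι ι ℂ :=
  cfc (fun t : ℝ => if r < t then (1 : ℝ) else 0) A

/-- The generalized inverse square root `A^{-1/2}` of a positive semidefinite matrix `A`: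
an eigenvalue `t > 0` is sent to `1/√t`, and the eigenvalue `0` to `0` (as `(√0)⁻¹ = 0`). -/
def invSqrt (A : Matrix ι ι ℂ) : Matrix ι ι ℂ :=
  cfc (fun t : ℝ => (Real.sqrt t)⁻¹) A

/-- The largest eigenvalue of a Hermitian matrix. -/
def lambdaMax (A : Matrix ι ι ℂ) : ℝ :=
  sSup (spectrum ℝ A)

/-- `D_max = maxₓ ln λ_max(A^{-1/2} E_x A^{-1/2})`; the logarithm is taken after the maximum, which
is the same number, with `ln 0` read as `-∞` inside the maximum. -/
def dMax (A : Matrix ι ι ℂ) (E : X → Matrix ι ι ℂ) : ℝ :=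
  Real.log (⨆ x, lambdaMax (invSqrt A * E x * invSqrt A))

/-- The cost matrix `M(x) = A^{-1/2} E_x A^{-1/2} e^{-D_max}`. -/
def costMatrix (A : Matrix ι ι ℂ) (E : X → Matrix ι ι ℂ) (x : X) : Matrix ι ι ℂ :=
  Real.exp (-dMax A E) • (invSqrt A * E x * invSqrt A)

/-- The weight matrix of the matrix multiplicative weight update algorithm run on the range of the
projector `P`, `G(l) = exp(-ε ∑_{l' < l} M(x_{l'}))`, where the exponential is the one of operators
on the range of `P`. Such operators are seen as operators on the whole space that vanish on the
kernel of `P`, hence the factor `P`; in the first round `G = P`. -/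
def weight {L : ℕ} (P : Matrix ι ι ℂ) (ε : ℝ) (M : X → Matrix ι ι ℂ) (x : Fin L → X) (l : Fin L) :
    Matrix ι ι ℂ :=
  P * NormedSpace.exp (-(ε • ∑ l' ∈ Finset.Iio l, M (x l')))

/-- The mixed state `F(l) = G(l) / Tr G(l)`. -/
def mixedState {L : ℕ} (P : Matrix ι ι ℂ) (ε : ℝ) (M : X → Matrix ι ι ℂ) (x : Fin L → X)
    (l : Fin L) : Matrix ι ι ℂ :=
  (weight P ε M x l).trace⁻¹ • weight P ε M x l

/-- `x_1, …, x_L` is a possible outcome of `L` rounds of the algorithm on the range of `P`: in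
each round `l` the pure strategy `x_l` maximizes `Tr (F(l) M(x))` (ties are broken arbitrarily). -/
def IsMMWURun {L : ℕ} (P : Matrix ι ι ℂ) (ε : ℝ) (M : X → Matrix ι ι ℂ) (x : Fin L → X) : Prop :=
  ∀ l : Fin L, ∀ y : X,
    (mixedState P ε M x l * M y).trace.re ≤ (mixedState P ε M x l * M (x l)).trace.re

/-- The projector `Π₁` onto the eigenspaces of `E_p` with eigenvalue larger than `τ₀ / dim V`. -/
def largeProj [Fintype X] (p : X → ℝ) (E : X → Matrix ι ι ℂ) (τ₀ : ℝ) : Matrix ι ι ℂ :=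
  projGT (avg p E) (τ₀ / Fintype.card ι)

/-- The pinching map `A ↦ Π A Π`. -/
def pinch (P A : Matrix ι ι ℂ) : Matrix ι ι ℂ := P * A * P

/-- `x_1, …, x_L` is a codebook obtained by the algorithm from the pinched edges
`Π₁ E_x Π₁`, with the cost matrices taken relative to `Π₁ E_p Π₁` and the algorithm run on the
support of `Π₁ E_p Π₁`. -/
def IsMMWUCodebook [Fintype X] {L : ℕ} (p : X → ℝ) (E : X → Matrix ι ι ℂ) (ε τ₀ : ℝ)
    (x : Fin L → X) : Prop :=
  let P₁ := largeProj p E τ₀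
  let A := pinch P₁ (avg p E)
  IsMMWURun (projGT A 0) ε (costMatrix A fun y => pinch P₁ (E y)) x

end SoftCovering

end

open SoftCovering

/-!
In each round the MMWU algorithm lowers the potential `Tr (P exp (-ε ∑ M(x_l)))`, where `P` projects
onto the support of `Π₁ E_p Π₁`: by Golden–Thompson and the bound of `exp (-ε M)` by its chord, one
round multiplies the potential by at most `1 - (1 - e^{-ε}) Tr (F(l) M(x_l))`. The `p`-average of
the cost matrices is `e^{-D_max} P`, so the maximizing `x_l` has `Tr (F(l) M(x_l)) ≥ e^{-D_max}`.
Since the potential starts at `Tr P` and bounds `exp (-ε λ)` for every eigenvalue `λ` of `∑ M(x_l)`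
on the range of `P`, once `L` is large this sum dominates `(1 - 2ε) L e^{-D_max} P`. Conjugation by
`(Π₁ E_p Π₁)^{1/2}` turns this into `(1 - 2ε) Π₁ E_p Π₁ ≤ Π₁ E_C Π₁`. The part of `E_p` outside `Π₁`
has trace at most `τ₀`, and the gentle measurement lemma controls the part of `E_C` outside `Π₁`.
-/

namespace SoftCovering

open Filter Topology

section LieTrotter

variable {𝔸 : Type*} [NormedRing 𝔸]

theorem norm_pow_sub_pow_le [NormOneClass 𝔸] {x y : 𝔸} {c : ℝ} (hc : 1 ≤ c) (hx : ‖x‖ ≤ c)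
    (hy : ‖y‖ ≤ c) (n : ℕ) :
    ‖x ^ n - y ^ n‖ ≤ n * c ^ n * ‖x - y‖ := by
  have : 0 ≤ c := zero_le_one.trans hc
  induction n with
  | zero => simp
  | succ n ih =>
    have hxn : ‖x ^ n‖ ≤ c ^ n := (norm_pow_le _ _).trans (by gcongr)
    calc ‖x ^ (n + 1) - y ^ (n + 1)‖
        = ‖x ^ n * (x - y) + (x ^ n - y ^ n) * y‖ := by
          rw [pow_succ, pow_succ]; congr 1; noncomm_ring
      _ ≤ ‖x ^ n‖ * ‖x - y‖ + ‖x ^ n - y ^ n‖ * ‖y‖ :=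
          (norm_add_le _ _).trans (add_le_add (norm_mul_le _ _) (norm_mul_le _ _))
      _ ≤ c ^ n * ‖x - y‖ + n * c ^ n * ‖x - y‖ * c := by gcongr
      _ ≤ c ^ n * ‖x - y‖ * c + n * c ^ n * ‖x - y‖ * c :=
          add_le_add_left (le_mul_of_one_le_right (by positivity) hc) _
      _ = ((n + 1 : ℕ) : ℝ) * c ^ (n + 1) * ‖x - y‖ := by push_cast; ring

variable [NormedAlgebra ℝ 𝔸] {f : ℝ → 𝔸} {z : 𝔸}

theorem tendsto_natCast_smul_sub (hf : HasDerivAt f z 0) :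
    Tendsto (fun n : ℕ => (n : ℝ) • (f ((n : ℝ)⁻¹) - f 0)) atTop (𝓝 z) := by
  have hn : Tendsto (fun n : ℕ => (n : ℝ)⁻¹) atTop (𝓝[≠] (0 : ℝ)) := by
    refine tendsto_nhdsWithin_iff.2 ⟨tendsto_inv_atTop_nhds_zero_nat, ?_⟩
    filter_upwards [eventually_gt_atTop 0] with n hn
    simpa using hn.ne'
  simpa [Function.comp_def] using hf.tendsto_slope_zero.comp hn

theorem hasDerivAt_exp_smul_zero [CompleteSpace 𝔸] (z : 𝔸) :
    HasDerivAt (fun t : ℝ => NormedSpace.exp (t • z)) z 0 := by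
  simpa using hasDerivAt_exp_smul_const (𝕂 := ℝ) z 0

variable [NormOneClass 𝔸]

theorem eventually_norm_le_exp (hf : HasDerivAt f z 0) (hf0 : f 0 = 1) :
    ∀ᶠ n : ℕ in atTop, ‖f ((n : ℝ)⁻¹)‖ ≤ Real.exp ((‖z‖ + 1) / n) := by
  filter_upwards [(tendsto_natCast_smul_sub hf).norm.eventually_le_const (lt_add_one ‖z‖),
    eventually_gt_atTop 0] with n hslope hn
  rw [norm_smul, Real.norm_natCast, hf0, mul_comm, ← le_div_iff₀ (by positivity)] at hslope
  calc ‖f ((n : ℝ)⁻¹)‖ = ‖(f ((n : ℝ)⁻¹) - 1) + 1‖ := by rw [sub_add_cancel]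
    _ ≤ (‖z‖ + 1) / n + 1 := (norm_add_le _ _).trans (by rw [norm_one]; gcongr)
    _ ≤ Real.exp ((‖z‖ + 1) / n) := Real.add_one_le_exp _

theorem tendsto_pow_sub_pow {g : ℝ → 𝔸} (hf : HasDerivAt f z 0) (hg : HasDerivAt g z 0)
    (hf0 : f 0 = 1) (hg0 : g 0 = 1) :
    Tendsto (fun n : ℕ => f ((n : ℝ)⁻¹) ^ n - g ((n : ℝ)⁻¹) ^ n) atTop (𝓝 0) := by
  have hbound := (tendsto_natCast_smul_sub (hf.sub hg)).norm.const_mul (Real.exp (‖z‖ + 1))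
  simp only [sub_self, norm_zero, mul_zero, Pi.sub_apply, hf0, hg0, sub_zero] at hbound
  refine squeeze_zero_norm' ?_ hbound
  filter_upwards [eventually_norm_le_exp hf hf0, eventually_norm_le_exp hg hg0,
    eventually_gt_atTop 0] with n hfn hgn hn
  calc ‖f ((n : ℝ)⁻¹) ^ n - g ((n : ℝ)⁻¹) ^ n‖
      ≤ n * Real.exp ((‖z‖ + 1) / n) ^ n * ‖f ((n : ℝ)⁻¹) - g ((n : ℝ)⁻¹)‖ :=
        norm_pow_sub_pow_le (Real.one_le_exp (by positivity)) hfn hgn n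
    _ = Real.exp (‖z‖ + 1) * ‖(n : ℝ) • (f ((n : ℝ)⁻¹) - g ((n : ℝ)⁻¹))‖ := by
        rw [← Real.exp_nat_mul, mul_div_cancel₀ _ (by positivity), norm_smul, Real.norm_natCast]
        ring

variable [CompleteSpace 𝔸]

theorem tendsto_pow_exp_of_hasDerivAt (hf : HasDerivAt f z 0) (hf0 : f 0 = 1) :
    Tendsto (fun n : ℕ => f ((n : ℝ)⁻¹) ^ n) atTop (𝓝 (NormedSpace.exp z)) := by
  rw [← tendsto_sub_nhds_zero_iff]
  refine (tendsto_pow_sub_pow hf (hasDerivAt_exp_smul_zero z) hf0 (by simp)).congr' ?_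
  filter_upwards [eventually_gt_atTop 0] with n hn
  let : NormedAlgebra ℚ 𝔸 := NormedAlgebra.restrictScalars ℚ ℝ 𝔸
  rw [← NormedSpace.exp_nsmul, ← Nat.cast_smul_eq_nsmul ℝ, smul_smul,
    mul_inv_cancel₀ (by positivity), one_smul]

theorem tendsto_exp_mul_exp_pow (a b : 𝔸) :
    Tendsto (fun n : ℕ => (NormedSpace.exp ((n : ℝ)⁻¹ • a) * NormedSpace.exp ((n : ℝ)⁻¹ • b)) ^ n)
      atTop (𝓝 (NormedSpace.exp (a + b))) := by
  have hprod := (hasDerivAt_exp_smul_zero a).mul (hasDerivAt_exp_smul_zero b)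
  simp only [zero_smul, NormedSpace.exp_zero, mul_one, one_mul] at hprod
  exact tendsto_pow_exp_of_hasDerivAt hprod (by simp)

end LieTrotter

section GoldenThompson

variable {ι 𝕜 : Type*} [Fintype ι] [RCLike 𝕜]

/-- Cauchy–Schwarz for the sesquilinear form `(A, B) ↦ Tr (A σ Bᴴ)`. -/
theorem norm_trace_mul_mul_sq_le {σ : Matrix ι ι 𝕜} (hσ : σ.PosSemidef) (A B : Matrix ι ι 𝕜) :
    ‖(A * σ * B).trace‖ ^ 2 ≤ RCLike.re (A * σ * Aᴴ).trace * RCLike.re (Bᴴ * σ * B).trace := by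
  let := Matrix.toMatrixSeminormedAddCommGroup σ hσ
  let := Matrix.toMatrixInnerProductSpace σ hσ
  have hinner (C D : Matrix ι ι 𝕜) : inner 𝕜 D C = (C * σ * Dᴴ).trace := rfl
  have h := inner_mul_inner_self_le (𝕜 := 𝕜) Bᴴ A
  rw [norm_inner_symm A, ← sq] at h
  simpa only [hinner, Matrix.conjTranspose_conjTranspose, mul_comm] using h

theorem norm_trace_mul_sq_le (A B : Matrix ι ι 𝕜) :
    ‖(A * B).trace‖ ^ 2 ≤ ‖(A * Aᴴ).trace‖ * ‖(B * Bᴴ).trace‖ := by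
  classical
  have h := norm_trace_mul_mul_sq_le Matrix.PosSemidef.one A B
  simp only [mul_one] at h
  rw [Matrix.trace_mul_comm Bᴴ] at h
  exact h.trans (mul_le_mul (RCLike.re_le_norm _) (RCLike.re_le_norm _)
    (RCLike.nonneg_iff.1 (Matrix.posSemidef_self_mul_conjTranspose B).trace_nonneg).1
    (norm_nonneg _))

variable [DecidableEq ι]

theorem trace_mul_pow_comm {R : Type*} [CommSemiring R] (A B : Matrix ι ι R) (n : ℕ) :
    ((A * B) ^ n).trace = ((B * A) ^ n).trace := by
  cases n with
  | zero => simp only [pow_zero]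
  | succ n =>
    rw [pow_succ, ← mul_assoc, mul_pow_mul, mul_assoc, Matrix.trace_mul_comm, mul_assoc, ← pow_succ]

/-- The two bounds feed each other in the induction: the first for `X²` reduces to the second for
`X Xᴴ` and `Xᴴ X`, and the second for `A`, `B` to the first for `A B`. -/
theorem norm_trace_pow_two_pow_le (k : ℕ) :
    (∀ X : Matrix ι ι 𝕜, ‖(X ^ 2 ^ (k + 1)).trace‖ ≤ ‖((X * Xᴴ) ^ 2 ^ k).trace‖) ∧
      ∀ A B : Matrix ι ι 𝕜, A.IsHermitian → B.IsHermitian →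
        ‖((A * B) ^ 2 ^ k).trace‖ ≤ ‖(A ^ 2 ^ k * B ^ 2 ^ k).trace‖ := by
  induction k with
  | zero =>
    refine ⟨fun X => ?_, fun A B _ _ => by simp⟩
    have h := norm_trace_mul_sq_le X X
    rw [← sq, ← sq] at h
    simpa using le_of_sq_le_sq h (norm_nonneg _)
  | succ k ih =>
    obtain ⟨ihX, ihAB⟩ := ih
    refine ⟨fun X => ?_, fun A B hA hB => ?_⟩
    · have hXX := Matrix.isHermitian_mul_conjTranspose_self X
      have hXX' := Matrix.isHermitian_conjTranspose_mul_self X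
      refine le_of_sq_le_sq ?_ (norm_nonneg _)
      have hreorder : X ^ 2 * (X ^ 2)ᴴ = X * (X * Xᴴ * Xᴴ) := by
        rw [Matrix.conjTranspose_pow, sq, sq]; simp only [mul_assoc]
      calc ‖(X ^ 2 ^ (k + 1 + 1)).trace‖ ^ 2
          = ‖((X ^ 2) ^ 2 ^ (k + 1)).trace‖ ^ 2 := by rw [← pow_mul, ← pow_succ']
        _ ≤ ‖((X ^ 2 * (X ^ 2)ᴴ) ^ 2 ^ k).trace‖ ^ 2 := by gcongr; exact ihX _
        _ = ‖((X * Xᴴ * (Xᴴ * X)) ^ 2 ^ k).trace‖ ^ 2 := by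
            rw [hreorder, trace_mul_pow_comm, mul_assoc]
        _ ≤ ‖((X * Xᴴ) ^ 2 ^ k * (Xᴴ * X) ^ 2 ^ k).trace‖ ^ 2 := by
            gcongr; exact ihAB _ _ hXX hXX'
        _ ≤ ‖((X * Xᴴ) ^ 2 ^ (k + 1)).trace‖ * ‖((Xᴴ * X) ^ 2 ^ (k + 1)).trace‖ := by
            have h := norm_trace_mul_sq_le ((X * Xᴴ) ^ 2 ^ k) ((Xᴴ * X) ^ 2 ^ k)
            rwa [(hXX.pow _).eq, (hXX'.pow _).eq, ← sq ((X * Xᴴ) ^ _), ← sq ((Xᴴ * X) ^ _),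
              ← pow_mul, ← pow_mul, ← pow_succ] at h
        _ = ‖((X * Xᴴ) ^ 2 ^ (k + 1)).trace‖ ^ 2 := by rw [trace_mul_pow_comm Xᴴ X, ← sq]
    · have hreorder : A * B * (A * B)ᴴ = A * (B ^ 2 * A) := by
        rw [Matrix.conjTranspose_mul, hA.eq, hB.eq, sq]; simp only [mul_assoc]
      calc ‖((A * B) ^ 2 ^ (k + 1)).trace‖
          ≤ ‖((A * B * (A * B)ᴴ) ^ 2 ^ k).trace‖ := ihX _
        _ = ‖((A ^ 2 * B ^ 2) ^ 2 ^ k).trace‖ := by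
            rw [hreorder, trace_mul_pow_comm A, mul_assoc, ← sq, trace_mul_pow_comm (B ^ 2)]
        _ ≤ ‖((A ^ 2) ^ 2 ^ k * (B ^ 2) ^ 2 ^ k).trace‖ := ihAB _ _ (hA.pow 2) (hB.pow 2)
        _ = ‖(A ^ 2 ^ (k + 1) * B ^ 2 ^ (k + 1)).trace‖ := by
            rw [← pow_mul, ← pow_mul, ← pow_succ']

theorem exp_inv_smul_pow {n : ℕ} (hn : n ≠ 0) (A : Matrix ι ι 𝕜) :
    NormedSpace.exp ((n : ℝ)⁻¹ • A) ^ n = NormedSpace.exp A := by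
  rw [← Matrix.exp_nsmul, ← Nat.cast_smul_eq_nsmul ℝ, smul_smul,
    mul_inv_cancel₀ (by positivity), one_smul]

open scoped Matrix.Norms.Operator in
/-- The Golden–Thompson inequality. -/
theorem norm_trace_exp_add_le {H K : Matrix ι ι 𝕜} (hH : H.IsHermitian) (hK : K.IsHermitian) :
    ‖(NormedSpace.exp (H + K)).trace‖ ≤ ‖(NormedSpace.exp H * NormedSpace.exp K).trace‖ := by
  cases isEmpty_or_nonempty ι
  · simp [Matrix.trace]
  have htrotter := (tendsto_exp_mul_exp_pow H K).comp
    (tendsto_pow_atTop_atTop_of_one_lt (one_lt_two (α := ℕ)))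
  have htrace : Continuous fun A : Matrix ι ι 𝕜 => ‖A.trace‖ := continuous_id.matrix_trace.norm
  refine le_of_tendsto ((htrace.tendsto _).comp htrotter) (Eventually.of_forall fun k => ?_)
  have h := (norm_trace_pow_two_pow_le k).2 _ _ (hH.smul (.all ((2 ^ k : ℕ) : ℝ)⁻¹)).exp
    (hK.smul (.all ((2 ^ k : ℕ) : ℝ)⁻¹)).exp
  rwa [exp_inv_smul_pow (by positivity), exp_inv_smul_pow (by positivity)] at h

end GoldenThompson

open scoped MatrixOrder

section LoewnerOrder

theorem real_smul_nonneg {ι : Type*} {A : Matrix ι ι ℂ} {r : ℝ} (hr : 0 ≤ r) (hA : 0 ≤ A) :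
    0 ≤ r • A :=
  Matrix.nonneg_iff_posSemidef.2 ((Matrix.nonneg_iff_posSemidef.1 hA).smul hr)

variable {ι : Type*} [Fintype ι]

theorem re_trace_mono {A B : Matrix ι ι ℂ} (hAB : A ≤ B) : A.trace.re ≤ B.trace.re :=
  (Complex.le_def.1 (OrderHomClass.mono (Matrix.tracePositiveLinearMap ι ℂ ℂ) hAB)).1

theorem trace_mul_nonneg {A B : Matrix ι ι ℂ} (hA : 0 ≤ A) (hB : 0 ≤ B) : 0 ≤ (A * B).trace := by
  classical
  obtain ⟨R, rfl⟩ := CStarAlgebra.nonneg_iff_eq_star_mul_self.1 hA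
  rw [mul_assoc, Matrix.trace_mul_comm]
  exact (Matrix.nonneg_iff_posSemidef.1 (star_right_conjugate_nonneg hB R)).trace_nonneg

theorem re_trace_mul_le_mul_left {A B C : Matrix ι ι ℂ} (hC : 0 ≤ C) (hAB : A ≤ B) :
    (C * A).trace.re ≤ (C * B).trace.re := by
  rw [← sub_nonneg, ← Complex.sub_re, ← Matrix.trace_sub, ← mul_sub]
  exact (Complex.le_def.1 (trace_mul_nonneg hC (sub_nonneg.2 hAB))).1

theorem re_trace_nonneg {A : Matrix ι ι ℂ} (hA : 0 ≤ A) : 0 ≤ A.trace.re := by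
  simpa using re_trace_mono hA

theorem re_trace_conjTranspose (A : Matrix ι ι ℂ) : Aᴴ.trace.re = A.trace.re := by
  rw [Matrix.trace_conjTranspose, ← starRingEnd_apply, Complex.conj_re]

theorem re_trace_real_smul (r : ℝ) (A : Matrix ι ι ℂ) : (r • A).trace.re = r * A.trace.re := by
  rw [Matrix.trace_smul, Complex.smul_re, smul_eq_mul]

variable [DecidableEq ι]

theorem le_real_smul_one_iff {A : Matrix ι ι ℂ} (hA : IsSelfAdjoint A) {r : ℝ} :
    A ≤ r • (1 : Matrix ι ι ℂ) ↔ ∀ t ∈ spectrum ℝ A, t ≤ r := by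
  rw [← Algebra.algebraMap_eq_smul_one, le_algebraMap_iff_spectrum_le hA]

theorem le_trace_smul_one {A : Matrix ι ι ℂ} (hA : 0 ≤ A) :
    A ≤ A.trace.re • (1 : Matrix ι ι ℂ) := by
  have hA' := Matrix.nonneg_iff_posSemidef.1 hA
  rw [le_real_smul_one_iff hA'.isHermitian, hA'.isHermitian.spectrum_real_eq_range_eigenvalues]
  rintro _ ⟨i, rfl⟩
  have htrace : A.trace.re = ∑ j, hA'.isHermitian.eigenvalues j := by
    simpa using congrArg Complex.re hA'.isHermitian.trace_eq_sum_eigenvalues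
  rw [htrace]
  exact Finset.single_le_sum (fun j _ => hA'.eigenvalues_nonneg j) (Finset.mem_univ i)

theorem continuousOn_spectrum (f : ℝ → ℝ) (A : Matrix ι ι ℂ) : ContinuousOn f (spectrum ℝ A) :=
  A.finite_real_spectrum.continuousOn f

theorem cfc_mul_cfc (f g : ℝ → ℝ) (A : Matrix ι ι ℂ) :
    cfc f A * cfc g A = cfc (fun t => f t * g t) A :=
  (cfc_mul f g A (continuousOn_spectrum f A) (continuousOn_spectrum g A)).symm

theorem le_one_of_mul_self_eq_one {S : Matrix ι ι ℂ} (hS : IsSelfAdjoint S) (hSS : S * S = 1) :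
    S ≤ 1 := by
  have hsq : 1 - S = (2⁻¹ : ℝ) • ((1 - S) * 1 * (1 - S)) := by
    simp only [mul_one, sub_mul, mul_sub, one_mul, hSS]
    module
  rw [← sub_nonneg, hsq]
  have : IsSelfAdjoint (1 - S) := .sub (.one _) hS
  exact smul_nonneg (by norm_num) (this.conjugate_nonneg zero_le_one)

end LoewnerOrder

section TraceNorm

variable {ι : Type*} [Fintype ι] [DecidableEq ι]

theorem traceNorm_eq_re_trace_abs (A : Matrix ι ι ℂ) : traceNorm A = (CFC.abs A).trace.re := by
  rw [traceNorm, CFC.abs, CFC.sqrt_eq_real_sqrt _ (star_mul_self_nonneg A), cfcₙ_eq_cfc]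
  rfl

theorem traceNorm_neg (A : Matrix ι ι ℂ) : traceNorm (-A) = traceNorm A := by
  rw [traceNorm_eq_re_trace_abs, traceNorm_eq_re_trace_abs, CFC.abs_neg]

theorem traceNorm_of_nonneg {A : Matrix ι ι ℂ} (hA : 0 ≤ A) : traceNorm A = A.trace.re := by
  rw [traceNorm_eq_re_trace_abs, CFC.abs_of_nonneg A]

theorem exists_traceNorm_eq_re_trace_mul {D : Matrix ι ι ℂ} (hD : IsSelfAdjoint D) :
    ∃ S : Matrix ι ι ℂ, IsSelfAdjoint S ∧ S * S = 1 ∧ traceNorm D = (S * D).trace.re := by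
  let s : ℝ → ℝ := fun t => if 0 ≤ t then 1 else -1
  refine ⟨cfc s D, cfc_predicate s D, ?_, ?_⟩
  · rw [cfc_mul_cfc, ← cfc_one ℝ D hD]
    congr! 2 with t
    simp only [s]
    split_ifs <;> norm_num
  · have habs : CFC.abs D = cfc s D * D :=
      calc CFC.abs D = cfc (‖·‖) D := CFC.abs_eq_cfc_norm D hD
        _ = cfc s D * cfc (fun t => t) D := by
            rw [cfc_mul_cfc]
            congr! 2 with t
            simp only [s]
            split_ifs with ht
            · rw [one_mul, Real.norm_of_nonneg ht]
            · rw [neg_one_mul, Real.norm_of_nonpos (not_le.1 ht).le]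
        _ = cfc s D * D := by rw [cfc_id' ℝ D hD]
    rw [traceNorm_eq_re_trace_abs, habs]

theorem re_trace_mul_le_traceNorm {S D : Matrix ι ι ℂ} (hS : IsSelfAdjoint S) (hSS : S * S = 1)
    (hD : IsSelfAdjoint D) : (S * D).trace.re ≤ traceNorm D := by
  have hneg : -S ≤ 1 := le_one_of_mul_self_eq_one hS.neg (by rw [neg_mul_neg, hSS])
  have hpos := re_trace_mul_le_mul_left (CFC.posPart_nonneg D) (le_one_of_mul_self_eq_one hS hSS)
  have hneg := re_trace_mul_le_mul_left (CFC.negPart_nonneg D) hneg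
  calc (S * D).trace.re
      = (D⁺ * S).trace.re + (D⁻ * -S).trace.re := by
        rw [Matrix.trace_mul_comm, ← Complex.add_re, ← Matrix.trace_add, mul_neg, ← sub_eq_add_neg,
          ← sub_mul, CFC.posPart_sub_negPart D hD]
    _ ≤ D⁺.trace.re + D⁻.trace.re := by simpa only [mul_one] using add_le_add hpos hneg
    _ = traceNorm D := by
        rw [traceNorm_eq_re_trace_abs, ← CFC.posPart_add_negPart D hD, Matrix.trace_add,
          Complex.add_re]

theorem traceNorm_add_le {A B : Matrix ι ι ℂ} (hA : IsSelfAdjoint A) (hB : IsSelfAdjoint B) :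
    traceNorm (A + B) ≤ traceNorm A + traceNorm B := by
  obtain ⟨S, hS, hSS, hnorm⟩ := exists_traceNorm_eq_re_trace_mul (hA.add hB)
  rw [hnorm, mul_add, Matrix.trace_add, Complex.add_re]
  exact add_le_add (re_trace_mul_le_traceNorm hS hSS hA) (re_trace_mul_le_traceNorm hS hSS hB)

theorem traceNorm_sub_le {A B : Matrix ι ι ℂ} (hA : IsSelfAdjoint A) (hB : IsSelfAdjoint B) :
    traceNorm (A - B) ≤ traceNorm A + traceNorm B := by
  simpa only [sub_eq_add_neg, traceNorm_neg] using traceNorm_add_le hA hB.neg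

end TraceNorm

section Pinching

variable {ι : Type*} [Fintype ι]

theorem pinch_nonneg {P A : Matrix ι ι ℂ} (hP : IsSelfAdjoint P) (hA : 0 ≤ A) : 0 ≤ pinch P A :=
  hP.conjugate_nonneg hA

theorem re_trace_pinch {P : Matrix ι ι ℂ} (hP : IsIdempotentElem P) (A : Matrix ι ι ℂ) :
    (pinch P A).trace.re = (P * A).trace.re := by
  rw [pinch, Matrix.trace_mul_comm, ← mul_assoc, hP.eq]

theorem pinch_pinch {P : Matrix ι ι ℂ} (hP : IsIdempotentElem P) (A : Matrix ι ι ℂ) :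
    pinch P (pinch P A) = pinch P A := by
  rw [pinch, pinch, ← mul_assoc, ← mul_assoc, hP.eq, mul_assoc _ P P, hP.eq]

theorem re_trace_pinch_one_sub [DecidableEq ι] {P : Matrix ι ι ℂ} (hP : IsStarProjection P)
    (A : Matrix ι ι ℂ) :
    (pinch (1 - P) A).trace.re = A.trace.re - (pinch P A).trace.re := by
  rw [re_trace_pinch hP.one_sub.isIdempotentElem, re_trace_pinch hP.isIdempotentElem, sub_mul,
    one_mul, Matrix.trace_sub, Complex.sub_re]

theorem re_trace_pinch_le {P A : Matrix ι ι ℂ} (hP : IsStarProjection P) (hA : 0 ≤ A) :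
    (pinch P A).trace.re ≤ A.trace.re := by
  classical
  rw [← sub_nonneg, ← re_trace_pinch_one_sub hP]
  exact re_trace_nonneg (pinch_nonneg hP.one_sub.isSelfAdjoint hA)

theorem pinch_le_of_commute {P A : Matrix ι ι ℂ} (hP : IsStarProjection P) (hA : 0 ≤ A)
    (hPA : Commute P A) : pinch P A ≤ A := by
  classical
  have hcompl : A - pinch P A = pinch (1 - P) A := by
    simp only [pinch, sub_mul, mul_sub, one_mul, mul_one, hPA.eq, mul_assoc, hP.isIdempotentElem.eq]
    abel
  rw [← sub_nonneg, hcompl]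
  exact pinch_nonneg hP.one_sub.isSelfAdjoint hA

variable [DecidableEq ι]

theorem pinch_le_smul_one {P A : Matrix ι ι ℂ} (hP : IsStarProjection P) {r : ℝ} (hr : 0 ≤ r)
    (hA : A ≤ r • (1 : Matrix ι ι ℂ)) : pinch P A ≤ r • (1 : Matrix ι ι ℂ) := by
  calc pinch P A ≤ P * (r • 1) * P := hP.isSelfAdjoint.conjugate_le_conjugate hA
    _ = r • P := by rw [mul_smul_comm, mul_one, smul_mul_assoc, hP.isIdempotentElem.eq]
    _ ≤ r • 1 := smul_le_smul_of_nonneg_left hP.le_one hr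

theorem norm_trace_mul_mul_one_sub_le {P σ : Matrix ι ι ℂ} (hP : IsStarProjection P) (hσ : 0 ≤ σ)
    (A : Matrix ι ι ℂ) :
    ‖(A * σ * (1 - P)).trace‖ ≤
      √((A * σ * Aᴴ).trace.re * (σ.trace.re - (pinch P σ).trace.re)) := by
  have hconj : (1 - P)ᴴ = 1 - P := hP.one_sub.isSelfAdjoint
  have h := norm_trace_mul_mul_sq_le (Matrix.nonneg_iff_posSemidef.1 hσ) A (1 - P)
  rw [hconj, ← pinch, RCLike.re_eq_complex_re, re_trace_pinch_one_sub hP] at h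
  exact Real.le_sqrt_of_sq_le h

theorem re_trace_mul_sub_pinch {S P σ : Matrix ι ι ℂ} (hS : S.IsHermitian) (hP : P.IsHermitian)
    (hσ : σ.IsHermitian) :
    (S * (σ - pinch P σ)).trace.re =
      (S * σ * (1 - P)).trace.re + (S * P * σ * (1 - P)).trace.re := by
  have hadj : (S * P * σ * (1 - P))ᴴ = (1 - P) * σ * P * S := by
    simp only [Matrix.conjTranspose_mul, Matrix.conjTranspose_sub, Matrix.conjTranspose_one,
      hS.eq, hP.eq, hσ.eq, mul_assoc]
  rw [← re_trace_conjTranspose (S * P * σ * (1 - P)), hadj, Matrix.trace_mul_comm _ S,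
    ← Complex.add_re, ← Matrix.trace_add, pinch]
  congr 2
  noncomm_ring

/-- The gentle measurement lemma. -/
theorem traceNorm_sub_pinch_le {P σ : Matrix ι ι ℂ} (hP : IsStarProjection P) (hσ : 0 ≤ σ) :
    traceNorm (σ - pinch P σ) ≤
      2 * √(σ.trace.re * (σ.trace.re - (pinch P σ).trace.re)) := by
  have hP_sa : Pᴴ = P := hP.isSelfAdjoint
  obtain ⟨S, hS, hSS, hnorm⟩ := exists_traceNorm_eq_re_trace_mul
    (.sub (.of_nonneg hσ) (.of_nonneg (pinch_nonneg hP.isSelfAdjoint hσ)) :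
      IsSelfAdjoint (σ - pinch P σ))
  have hS_sa : Sᴴ = S := hS
  have htrace_conj (A : Matrix ι ι ℂ) : (S * A * Sᴴ).trace = A.trace := by
    rw [Matrix.trace_mul_comm, ← mul_assoc, hS_sa, hSS, one_mul]
  have hσ_part := norm_trace_mul_mul_one_sub_le hP hσ S
  rw [htrace_conj] at hσ_part
  have hpinch_part := norm_trace_mul_mul_one_sub_le hP hσ (S * P)
  have hSP : S * P * σ * (S * P)ᴴ = S * pinch P σ * Sᴴ := by
    simp only [Matrix.conjTranspose_mul, hP_sa, pinch, mul_assoc]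
  rw [hSP, htrace_conj] at hpinch_part
  calc traceNorm (σ - pinch P σ)
      ≤ ‖(S * σ * (1 - P)).trace‖ + ‖(S * P * σ * (1 - P)).trace‖ := by
        rw [hnorm, re_trace_mul_sub_pinch hS hP.isSelfAdjoint (IsSelfAdjoint.of_nonneg hσ)]
        exact add_le_add (Complex.re_le_norm _) (Complex.re_le_norm _)
    _ ≤ 2 * √(σ.trace.re * (σ.trace.re - (pinch P σ).trace.re)) := by
        rw [two_mul]
        refine add_le_add hσ_part (hpinch_part.trans (Real.sqrt_le_sqrt ?_))
        exact mul_le_mul_of_nonneg_right (re_trace_pinch_le hP hσ)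
          (sub_nonneg.2 (re_trace_pinch_le hP hσ))

theorem traceNorm_sub_le_of_le_pinch {P ρ σ : Matrix ι ι ℂ} {ε τ τ₀ : ℝ}
    (hP : IsStarProjection P) (hρ : 0 ≤ ρ) (hσ : 0 ≤ σ) (hρ_trace : ρ.trace.re ≤ 1)
    (hσ_trace : σ.trace.re ≤ 1) (hε : 0 ≤ ε) (hPρ : pinch P ρ ≤ ρ) (hτ : 1 - τ ≤ ρ.trace.re)
    (hτ₀ : ρ.trace.re - (pinch P ρ).trace.re ≤ τ₀)
    (hle : (1 - 2 * ε) • pinch P ρ ≤ pinch P σ) :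
    traceNorm (ρ - σ) ≤ 4 * ε + τ + 2 * τ₀ + 2 * √(2 * ε + τ + τ₀) := by
  have hPρ_nonneg := pinch_nonneg hP.isSelfAdjoint hρ
  set D := pinch P σ - (1 - 2 * ε) • pinch P ρ with hD
  have hD_nonneg : 0 ≤ D := sub_nonneg.2 hle
  set B := (ρ - pinch P ρ) + (2 * ε) • pinch P ρ with hB
  have hB_nonneg : 0 ≤ B := add_nonneg (sub_nonneg.2 hPρ) (smul_nonneg (by positivity) hPρ_nonneg)
  have hσ_sa : IsSelfAdjoint (σ - pinch P σ) :=
    .sub (.of_nonneg hσ) (.of_nonneg (pinch_nonneg hP.isSelfAdjoint hσ))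
  have hdecomp : ρ - σ = B - D - (σ - pinch P σ) := by rw [hB, hD]; module
  have hB_norm : traceNorm B = ρ.trace.re - (1 - 2 * ε) * (pinch P ρ).trace.re := by
    rw [traceNorm_of_nonneg hB_nonneg, hB, Matrix.trace_add, Matrix.trace_sub, Complex.add_re,
      Complex.sub_re, re_trace_real_smul]
    ring
  have hD_norm : traceNorm D =
      (pinch P σ).trace.re - (1 - 2 * ε) * (pinch P ρ).trace.re := by
    rw [traceNorm_of_nonneg hD_nonneg, hD, Matrix.trace_sub, Complex.sub_re, re_trace_real_smul]
  have hPρ_trace : ε * (pinch P ρ).trace.re ≤ ε :=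
    mul_le_of_le_one_right hε ((re_trace_mono hPρ).trans hρ_trace)
  have hPσ_trace : (1 - 2 * ε) * (pinch P ρ).trace.re ≤ (pinch P σ).trace.re := by
    simpa only [re_trace_real_smul] using re_trace_mono hle
  have hPσ_trace' := re_trace_pinch_le hP hσ
  calc traceNorm (ρ - σ)
      ≤ traceNorm B + traceNorm D + traceNorm (σ - pinch P σ) := by
        rw [hdecomp]
        exact (traceNorm_sub_le (.sub (.of_nonneg hB_nonneg) (.of_nonneg hD_nonneg)) hσ_sa).trans
          (add_le_add_left (traceNorm_sub_le (.of_nonneg hB_nonneg) (.of_nonneg hD_nonneg)) _)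
    _ ≤ (4 * ε + τ + 2 * τ₀) + 2 * √(σ.trace.re * (σ.trace.re - (pinch P σ).trace.re)) := by
        refine add_le_add ?_ (traceNorm_sub_pinch_le hP hσ)
        rw [hB_norm, hD_norm]
        linarith
    _ ≤ 4 * ε + τ + 2 * τ₀ + 2 * √(2 * ε + τ + τ₀) := by
        gcongr
        refine (mul_le_of_le_one_left (by linarith) hσ_trace).trans ?_
        linarith

end Pinching

section ExponentialOnRange

variable {ι : Type*} [Fintype ι]

open scoped Matrix.Norms.L2Operator in
theorem mul_eq_of_nonneg_of_le {P A : Matrix ι ι ℂ} (hP : IsStarProjection P) (hA : 0 ≤ A)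
    (hAP : A ≤ P) : P * A = A := by
  classical
  exact (hP.mul_right_and_mul_left_of_nonneg_of_le hA hAP).2

variable [DecidableEq ι]

open scoped Matrix.Norms.L2Operator in
theorem exp_eq_cfc {H : Matrix ι ι ℂ} (hH : IsSelfAdjoint H) :
    NormedSpace.exp H = cfc Real.exp H :=
  (CFC.real_exp_eq_normedSpace_exp hH).symm

theorem exp_nonneg {H : Matrix ι ι ℂ} (hH : IsSelfAdjoint H) : 0 ≤ NormedSpace.exp H := by
  rw [exp_eq_cfc hH]
  exact cfc_nonneg fun t _ => (Real.exp_pos t).le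

theorem exp_le_one_iff {H : Matrix ι ι ℂ} (hH : IsSelfAdjoint H) :
    NormedSpace.exp H ≤ 1 ↔ H ≤ 0 := by
  rw [exp_eq_cfc hH, cfc_le_one_iff Real.exp H (continuousOn_spectrum _ _) hH,
    ← zero_smul ℝ (1 : Matrix ι ι ℂ), le_real_smul_one_iff hH]
  simp only [Real.exp_le_one_iff]

open scoped Matrix.Norms.L2Operator in
theorem semiconjBy_exp_right {C A B : Matrix ι ι ℂ} (h : SemiconjBy C A B) :
    SemiconjBy C (NormedSpace.exp A) (NormedSpace.exp B) :=
  let : NormedAlgebra ℚ (Matrix ι ι ℂ) := NormedAlgebra.restrictScalars ℚ ℝ (Matrix ι ι ℂ)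
  h.exp_right

theorem one_sub_mul_exp {H P : Matrix ι ι ℂ} (h : P * H = H) :
    (1 - P) * NormedSpace.exp H = 1 - P := by
  have hsemi : SemiconjBy (1 - P) H 0 := by
    rw [SemiconjBy, sub_mul, h, one_mul, sub_self, zero_mul]
  simpa only [NormedSpace.exp_zero, one_mul] using (semiconjBy_exp_right hsemi).eq

theorem exp_eq_proj_mul_exp_add {H P : Matrix ι ι ℂ} (h : P * H = H) :
    NormedSpace.exp H = P * NormedSpace.exp H + (1 - P) := by
  rw [← one_sub_mul_exp h, ← add_mul, add_sub_cancel, one_mul]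

theorem commute_exp {H P : Matrix ι ι ℂ} (hP : IsSelfAdjoint P) (hH : IsSelfAdjoint H)
    (h : P * H = H) : Commute P (NormedSpace.exp H) := by
  have hHP : H * P = H := by
    simpa only [star_mul, hH.star_eq, hP.star_eq] using congrArg star h
  exact semiconjBy_exp_right (h.trans hHP.symm)

theorem re_trace_exp_add_le {H K : Matrix ι ι ℂ} (hH : IsSelfAdjoint H) (hK : IsSelfAdjoint K) :
    (NormedSpace.exp (H + K)).trace.re ≤ (NormedSpace.exp H * NormedSpace.exp K).trace.re := by
  have hprod := trace_mul_nonneg (exp_nonneg hH) (exp_nonneg hK)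
  calc (NormedSpace.exp (H + K)).trace.re ≤ ‖(NormedSpace.exp (H + K)).trace‖ :=
        Complex.re_le_norm _
    _ ≤ ‖(NormedSpace.exp H * NormedSpace.exp K).trace‖ := norm_trace_exp_add_le hH hK
    _ = (NormedSpace.exp H * NormedSpace.exp K).trace.re := (Complex.re_eq_norm.2 hprod).symm

theorem re_trace_proj_mul_exp_add_le {H K P : Matrix ι ι ℂ} (hH : IsSelfAdjoint H)
    (hK : IsSelfAdjoint K) (hPH : P * H = H) (hPK : P * K = K) :
    (P * NormedSpace.exp (H + K)).trace.re ≤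
      (P * NormedSpace.exp H * NormedSpace.exp K).trace.re := by
  have hsum := exp_eq_proj_mul_exp_add (H := H + K) (by rw [mul_add, hPH, hPK])
  have hprod : NormedSpace.exp H * NormedSpace.exp K =
      P * NormedSpace.exp H * NormedSpace.exp K + (1 - P) := by
    nth_rw 1 [exp_eq_proj_mul_exp_add hPH]
    rw [add_mul, one_sub_mul_exp hPK]
  have h := re_trace_exp_add_le hH hK
  rw [hsum, hprod, Matrix.trace_add, Matrix.trace_add, Complex.add_re, Complex.add_re] at h
  linarith

theorem proj_mul_exp_nonneg {H P : Matrix ι ι ℂ} (hP : IsStarProjection P) (hH : IsSelfAdjoint H)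
    (hPH : P * H = H) : 0 ≤ P * NormedSpace.exp H := by
  have hpinch : P * NormedSpace.exp H = pinch P (NormedSpace.exp H) := by
    rw [pinch, mul_assoc, ← (commute_exp hP.isSelfAdjoint hH hPH).eq, ← mul_assoc,
      hP.isIdempotentElem.eq]
  rw [hpinch]
  exact pinch_nonneg hP.isSelfAdjoint (exp_nonneg hH)

/-- Convexity of the exponential: on `[0, 1]` it lies below its chord. -/
theorem exp_neg_smul_le {M : Matrix ι ι ℂ} (hM : 0 ≤ M) (hM1 : M ≤ 1) (ε : ℝ) :
    NormedSpace.exp (-(ε • M)) ≤ 1 - (1 - Real.exp (-ε)) • M := by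
  have hM_sa := IsSelfAdjoint.of_nonneg hM
  have hexp : NormedSpace.exp (-(ε • M)) = cfc (fun t => Real.exp (-ε * t)) M := by
    rw [exp_eq_cfc (((IsSelfAdjoint.all ε).smul hM_sa).neg), ← neg_smul]
    exact (cfc_comp_const_mul (-ε) Real.exp M (Real.continuous_exp.continuousOn) hM_sa).symm
  have hchord : 1 - (1 - Real.exp (-ε)) • M = cfc (fun t => 1 - (1 - Real.exp (-ε)) * t) M := by
    rw [cfc_sub (fun _ => 1) _ M (continuousOn_spectrum _ _) (continuousOn_spectrum _ _),
      cfc_const_one ℝ M, cfc_const_mul_id _ M]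
  rw [hexp, hchord]
  refine cfc_mono (fun t ht => ?_) (continuousOn_spectrum _ _) (continuousOn_spectrum _ _)
  have ht0 : 0 ≤ t := spectrum_nonneg_of_nonneg hM ht
  have ht1 : t ≤ 1 := (le_real_smul_one_iff hM_sa).1 (by rwa [one_smul]) t ht
  have hconv := convexOn_exp.2 (Set.mem_univ (-ε)) (Set.mem_univ 0) ht0 (sub_nonneg.2 ht1)
    (by ring)
  simp only [smul_eq_mul, mul_zero, add_zero, Real.exp_zero, mul_one] at hconv
  rw [mul_comm (-ε)]
  linarith

theorem re_trace_proj_mul_exp_add_neg_le {H M P : Matrix ι ι ℂ} (hP : IsStarProjection P)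
    (hH : IsSelfAdjoint H) (hPH : P * H = H) (hM : 0 ≤ M) (hMP : M ≤ P) (ε : ℝ) :
    (P * NormedSpace.exp (H + -(ε • M))).trace.re ≤ (P * NormedSpace.exp H).trace.re
      - (1 - Real.exp (-ε)) * (P * NormedSpace.exp H * M).trace.re := by
  have hM_sa := IsSelfAdjoint.of_nonneg hM
  calc (P * NormedSpace.exp (H + -(ε • M))).trace.re
      ≤ (P * NormedSpace.exp H * NormedSpace.exp (-(ε • M))).trace.re :=
        re_trace_proj_mul_exp_add_le hH ((IsSelfAdjoint.all ε).smul hM_sa).neg hPH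
          (by rw [mul_neg, mul_smul_comm, mul_eq_of_nonneg_of_le hP hM hMP])
    _ ≤ (P * NormedSpace.exp H * (1 - (1 - Real.exp (-ε)) • M)).trace.re :=
        re_trace_mul_le_mul_left (proj_mul_exp_nonneg hP hH hPH)
          (exp_neg_smul_le hM (hMP.trans hP.le_one) ε)
    _ = _ := by
        rw [mul_sub, mul_one, mul_smul_comm, Matrix.trace_sub, Complex.sub_re, re_trace_real_smul]

theorem nonpos_of_re_trace_proj_mul_exp_le_one {H P : Matrix ι ι ℂ} (hP : IsStarProjection P)
    (hH : IsSelfAdjoint H) (hPH : P * H = H) (htrace : (P * NormedSpace.exp H).trace.re ≤ 1) :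
    H ≤ 0 := by
  set W := P * NormedSpace.exp H with hW
  have hW_nonneg : 0 ≤ W := proj_mul_exp_nonneg hP hH hPH
  have hW_le_one : W ≤ 1 :=
    (le_trace_smul_one hW_nonneg).trans (smul_le_of_le_one_left zero_le_one htrace)
  have hW_pinch : P * W * P = W := by
    rw [hW, ← mul_assoc, hP.isIdempotentElem.eq, mul_assoc,
      ← (commute_exp hP.isSelfAdjoint hH hPH).eq, ← mul_assoc, hP.isIdempotentElem.eq]
  have hW_le : W ≤ P := by
    simpa only [hW_pinch, mul_one, hP.isIdempotentElem.eq] using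
      hP.isSelfAdjoint.conjugate_le_conjugate hW_le_one
  rwa [← exp_le_one_iff hH, exp_eq_proj_mul_exp_add hPH, ← hW, ← le_sub_iff_add_le,
    sub_sub_cancel]

theorem proj_mul_exp_smul {P : Matrix ι ι ℂ} (hP : IsIdempotentElem P) (c : ℝ) :
    P * NormedSpace.exp (c • P) = Real.exp c • P := by
  have hscalar : NormedSpace.exp (c • (1 : Matrix ι ι ℂ)) = Real.exp c • 1 := by
    rw [exp_eq_cfc (.smul (.all c) (.one _)), ← Algebra.algebraMap_eq_smul_one, cfc_algebraMap,
      Algebra.algebraMap_eq_smul_one]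
  have hsemi : SemiconjBy P (c • P) (c • 1) := by
    rw [SemiconjBy, mul_smul_comm, hP.eq, smul_mul_assoc, one_mul]
  rw [(semiconjBy_exp_right hsemi).eq, hscalar, smul_mul_assoc, one_mul]

theorem smul_le_of_re_trace_proj_mul_exp_le {S P : Matrix ι ι ℂ} {ε r : ℝ}
    (hP : IsStarProjection P) (hS : IsSelfAdjoint S) (hPS : P * S = S) (hε : 0 < ε)
    (htrace : (P * NormedSpace.exp (-(ε • S))).trace.re ≤ Real.exp (-(ε * r))) : r • P ≤ S := by
  have hSP : S * P = S := by
    simpa only [star_mul, hS.star_eq, hP.isSelfAdjoint.star_eq] using congrArg star hPS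
  set H := (ε * r) • P + -(ε • S) with hH
  have hexp : P * NormedSpace.exp H = Real.exp (ε * r) • (P * NormedSpace.exp (-(ε • S))) := by
    have hcomm : Commute ((ε * r) • P) (-(ε • S)) :=
      ((Commute.smul_right (hPS.trans hSP.symm) ε).neg_right).smul_left _
    rw [hH, Matrix.exp_add_of_commute _ _ hcomm, ← mul_assoc, proj_mul_exp_smul
      hP.isIdempotentElem, smul_mul_assoc]
  have hH_nonpos : H ≤ 0 := by
    refine nonpos_of_re_trace_proj_mul_exp_le_one hP ?_ ?_ ?_
    · exact ((IsSelfAdjoint.all _).smul hP.isSelfAdjoint).add ((IsSelfAdjoint.all ε).smul hS).neg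
    · rw [hH, mul_add, mul_smul_comm, hP.isIdempotentElem.eq, mul_neg, mul_smul_comm, hPS]
    · rw [hexp, re_trace_real_smul, ← Real.exp_zero, ← add_neg_cancel (ε * r), Real.exp_add]
      exact mul_le_mul_of_nonneg_left htrace (Real.exp_pos _).le
  rw [hH, ← sub_eq_add_neg, sub_nonpos, mul_smul] at hH_nonpos
  exact le_of_smul_le_smul_left hH_nonpos hε

end ExponentialOnRange

section Run

theorem le_mul_pow_of_forall_Iic_le {L : ℕ} {φ : Finset (Fin L) → ℝ} {q : ℝ} (hq : 0 ≤ q)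
    (hφ : ∀ l, φ (Finset.Iic l) ≤ φ (Finset.Iio l) * q) : φ Finset.univ ≤ φ ∅ * q ^ L := by
  have hprefix (k : ℕ) (hk : k ≤ L) : φ {l : Fin L | l < k} ≤ φ ∅ * q ^ k := by
    induction k with
    | zero => simp
    | succ k ih =>
      have hIic : Finset.Iic (⟨k, hk⟩ : Fin L) = ({l | l.val < k + 1} : Finset (Fin L)) := by
        ext l; simp [Fin.le_def]
      have hIio : Finset.Iio (⟨k, hk⟩ : Fin L) = ({l | l.val < k} : Finset (Fin L)) := by
        ext l; simp [Fin.lt_def]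
      calc φ {l : Fin L | l < k + 1}
          ≤ φ {l : Fin L | l < k} * q := by
            rw [← hIic, ← hIio]
            exact hφ ⟨k, hk⟩
        _ ≤ φ ∅ * q ^ k * q := mul_le_mul_of_nonneg_right (ih (by omega)) hq
        _ = φ ∅ * q ^ (k + 1) := by ring
  simpa using hprefix L le_rfl

theorem exists_forall_eq_apply_of_dependsOn_Iio {α β : Type*} [Preorder α] [WellFoundedLT α]
    [Nonempty β] {f : α → (α → β) → β} (hf : ∀ a, DependsOn (f a) (Set.Iio a)) :
    ∃ x, ∀ a, x a = f a x := by
  classical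
  inhabit β
  let step (a : α) (ih : ∀ b, b < a → β) : β := f a fun b => if h : b < a then ih b h else default
  refine ⟨wellFounded_lt.fix step, fun a => ?_⟩
  rw [WellFounded.fix_eq]
  exact hf a fun b hb => dif_pos hb

theorem exp_neg_le {ε : ℝ} (hε : 0 ≤ ε) : Real.exp (-ε) ≤ 1 - ε + ε ^ 2 := by
  rw [Real.exp_neg]
  refine inv_le_of_inv_le₀ (by nlinarith) ?_
  refine (inv_le_of_inv_le₀ (by positivity) ?_).trans (Real.add_one_le_exp ε)
  rw [inv_le_iff_one_le_mul₀ (by positivity)]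
  nlinarith [pow_nonneg hε 3]

theorem isSelfAdjoint_neg_smul_sum {ι X : Type*} {L : ℕ} {ε : ℝ} {M : X → Matrix ι ι ℂ}
    {x : Fin L → X} (hM : ∀ y, 0 ≤ M y) (s : Finset (Fin L)) :
    IsSelfAdjoint (-(ε • ∑ l ∈ s, M (x l))) := by
  have hsum : IsSelfAdjoint (∑ l ∈ s, M (x l)) :=
    isSelfAdjoint_sum s fun l _ => (Matrix.nonneg_iff_posSemidef.1 (hM (x l))).isHermitian
  exact ((IsSelfAdjoint.all ε).smul hsum).neg

variable {ι X : Type*} [Fintype ι]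

theorem re_trace_mul_avg_le [Fintype X] {p : X → ℝ} (hp : p ∈ stdSimplex ℝ X)
    {G : Matrix ι ι ℂ} {M : X → Matrix ι ι ℂ} {r : ℝ} (h : ∀ y, (G * M y).trace.re ≤ r) :
    (G * avg p M).trace.re ≤ r := by
  calc (G * avg p M).trace.re = ∑ y, p y * (G * M y).trace.re := by
        simp only [avg, Finset.mul_sum, mul_smul_comm, Matrix.trace_sum, Complex.re_sum,
          re_trace_real_smul]
    _ ≤ ∑ y, p y * r :=
        Finset.sum_le_sum fun y _ => mul_le_mul_of_nonneg_left (h y) (hp.1 y)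
    _ = r := by rw [← Finset.sum_mul, hp.2, one_mul]

variable {L : ℕ} {P : Matrix ι ι ℂ} {ε : ℝ} {M : X → Matrix ι ι ℂ} {x : Fin L → X}

theorem proj_mul_neg_smul_sum (hP : IsStarProjection P) (hM : ∀ y, 0 ≤ M y) (hMP : ∀ y, M y ≤ P)
    (s : Finset (Fin L)) :
    P * -(ε • ∑ l ∈ s, M (x l)) = -(ε • ∑ l ∈ s, M (x l)) := by
  rw [mul_neg, mul_smul_comm, Finset.mul_sum]
  simp only [mul_eq_of_nonneg_of_le hP (hM _) (hMP _)]

variable [DecidableEq ι]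

theorem weight_nonneg (hP : IsStarProjection P) (hM : ∀ y, 0 ≤ M y) (hMP : ∀ y, M y ≤ P)
    (l : Fin L) : 0 ≤ weight P ε M x l :=
  proj_mul_exp_nonneg hP (isSelfAdjoint_neg_smul_sum hM _) (proj_mul_neg_smul_sum hP hM hMP _)

theorem IsMMWURun.re_trace_weight_mul_le (hx : IsMMWURun P ε M x) {l : Fin L}
    (hG : 0 ≤ weight P ε M x l) (y : X) :
    (weight P ε M x l * M y).trace.re ≤ (weight P ε M x l * M (x l)).trace.re := by
  have htrace : 0 ≤ (weight P ε M x l).trace := (Matrix.nonneg_iff_posSemidef.1 hG).trace_nonneg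
  have hnormalize (B : Matrix ι ι ℂ) : (weight P ε M x l * B).trace.re =
      (weight P ε M x l).trace.re * (mixedState P ε M x l * B).trace.re := by
    rcases eq_or_ne (weight P ε M x l).trace 0 with h0 | h0
    · rw [h0, (Matrix.nonneg_iff_posSemidef.1 hG).trace_eq_zero_iff.1 h0]
      simp
    · rw [← Complex.re_ofReal_mul, ← Complex.eq_re_of_ofReal_le htrace, mixedState,
        smul_mul_assoc, Matrix.trace_smul, smul_eq_mul, mul_inv_cancel_left₀ h0]
  rw [hnormalize, hnormalize]
  exact mul_le_mul_of_nonneg_left (hx l y) (re_trace_nonneg hG)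

theorem IsMMWURun.mul_re_trace_weight_le [Fintype X] (hx : IsMMWURun P ε M x) {p : X → ℝ}
    (hp : p ∈ stdSimplex ℝ X) (hP : IsStarProjection P) {c : ℝ} (hcP : c • P ≤ avg p M)
    {l : Fin L} (hG : 0 ≤ weight P ε M x l) :
    c * (weight P ε M x l).trace.re ≤ (weight P ε M x l * M (x l)).trace.re := by
  calc c * (weight P ε M x l).trace.re = (weight P ε M x l * c • P).trace.re := by
        rw [mul_smul_comm, re_trace_real_smul, Matrix.trace_mul_comm, weight, ← mul_assoc,
          hP.isIdempotentElem.eq]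
    _ ≤ (weight P ε M x l * avg p M).trace.re := re_trace_mul_le_mul_left hG hcP
    _ ≤ (weight P ε M x l * M (x l)).trace.re :=
        re_trace_mul_avg_le hp (hx.re_trace_weight_mul_le hG)

theorem IsMMWURun.re_trace_proj_mul_exp_Iic_le [Fintype X] (hx : IsMMWURun P ε M x) {p : X → ℝ}
    (hp : p ∈ stdSimplex ℝ X) (hP : IsStarProjection P) (hM : ∀ y, 0 ≤ M y) (hMP : ∀ y, M y ≤ P)
    (hε : 0 ≤ ε) {c : ℝ} (hcP : c • P ≤ avg p M) (l : Fin L) :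
    (P * NormedSpace.exp (-(ε • ∑ l' ∈ Finset.Iic l, M (x l')))).trace.re ≤
      (weight P ε M x l).trace.re * Real.exp (-((1 - Real.exp (-ε)) * c)) := by
  have hG := weight_nonneg (ε := ε) (x := x) hP hM hMP l
  have hsum : -(ε • ∑ l' ∈ Finset.Iic l, M (x l')) =
      -(ε • ∑ l' ∈ Finset.Iio l, M (x l')) + -(ε • M (x l)) := by
    rw [← Finset.Iio_insert, Finset.sum_insert (by simp), smul_add, neg_add_rev]
  have hε' : 0 ≤ 1 - Real.exp (-ε) := sub_nonneg.2 (Real.exp_le_one_iff.2 (neg_nonpos.2 hε))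
  calc (P * NormedSpace.exp (-(ε • ∑ l' ∈ Finset.Iic l, M (x l')))).trace.re
      ≤ (weight P ε M x l).trace.re
          - (1 - Real.exp (-ε)) * (weight P ε M x l * M (x l)).trace.re := by
        rw [hsum]
        exact re_trace_proj_mul_exp_add_neg_le hP (isSelfAdjoint_neg_smul_sum hM _)
          (proj_mul_neg_smul_sum hP hM hMP _) (hM _) (hMP _) ε
    _ ≤ (weight P ε M x l).trace.re
          - (1 - Real.exp (-ε)) * (c * (weight P ε M x l).trace.re) := by
        gcongr
        exact hx.mul_re_trace_weight_le hp hP hcP hG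
    _ = (weight P ε M x l).trace.re * (-((1 - Real.exp (-ε)) * c) + 1) := by ring
    _ ≤ (weight P ε M x l).trace.re * Real.exp (-((1 - Real.exp (-ε)) * c)) :=
        mul_le_mul_of_nonneg_left (Real.add_one_le_exp _) (re_trace_nonneg hG)

/-- The regret bound of the algorithm. -/
theorem IsMMWURun.smul_le_sum [Fintype X] (hx : IsMMWURun P ε M x) {p : X → ℝ}
    (hp : p ∈ stdSimplex ℝ X) (hP : IsStarProjection P) (hM : ∀ y, 0 ≤ M y) (hMP : ∀ y, M y ≤ P)
    (hε : 0 < ε) {c : ℝ} (hc : 0 ≤ c) (hcP : c • P ≤ avg p M)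
    (hL : Real.log P.trace.re ≤ ε ^ 2 * (L * c)) :
    ((1 - 2 * ε) * (L * c)) • P ≤ ∑ l, M (x l) := by
  have hpotential : (P * NormedSpace.exp (-(ε • ∑ l, M (x l)))).trace.re ≤
      P.trace.re * Real.exp (-((1 - Real.exp (-ε)) * c)) ^ L := by
    simpa using le_mul_pow_of_forall_Iic_le
      (φ := fun s => (P * NormedSpace.exp (-(ε • ∑ l ∈ s, M (x l)))).trace.re)
      (Real.exp_pos _).le (hx.re_trace_proj_mul_exp_Iic_le hp hP hM hMP hε.le hcP)
  refine smul_le_of_re_trace_proj_mul_exp_le hP (.of_nonneg (Finset.sum_nonneg fun l _ => hM _))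
    (by simp only [Finset.mul_sum, mul_eq_of_nonneg_of_le hP (hM _) (hMP _)]) hε
    (hpotential.trans ?_)
  have hLc : 0 ≤ L * c := by positivity
  calc P.trace.re * Real.exp (-((1 - Real.exp (-ε)) * c)) ^ L
      ≤ Real.exp (ε ^ 2 * (L * c)) * Real.exp (L * -((1 - Real.exp (-ε)) * c)) := by
        rw [← Real.exp_nat_mul]
        gcongr
        exact (Real.le_exp_log _).trans (Real.exp_le_exp.2 hL)
    _ ≤ Real.exp (-(ε * ((1 - 2 * ε) * (L * c)))) := by
        rw [← Real.exp_add, Real.exp_le_exp]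
        nlinarith [mul_le_mul_of_nonneg_right (exp_neg_le hε.le) hLc]

theorem exists_isMMWURun [Finite X] [Nonempty X] (L : ℕ) (P : Matrix ι ι ℂ) (ε : ℝ)
    (M : X → Matrix ι ι ℂ) : ∃ x : Fin L → X, IsMMWURun P ε M x := by
  have hmax (F : Matrix ι ι ℂ) : ∃ z, ∀ y, (F * M y).trace.re ≤ (F * M z).trace.re :=
    Finite.exists_max _
  choose f hf using hmax
  obtain ⟨x, hx⟩ := exists_forall_eq_apply_of_dependsOn_Iio
    (f := fun (l : Fin L) x => f (mixedState P ε M x l)) fun l x x' hxx' => by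
      have hsum : ∑ l' ∈ Finset.Iio l, M (x l') = ∑ l' ∈ Finset.Iio l, M (x' l') :=
        Finset.sum_congr rfl fun j hj => by rw [hxx' j (Finset.mem_Iio.1 hj)]
      simp only [mixedState, weight, hsum]
  exact ⟨x, fun l y => (hf _ y).trans_eq (by rw [← hx l])⟩

end Run

section InverseSquareRoot

variable {ι : Type*} [Fintype ι] [DecidableEq ι]

theorem isStarProjection_projGT (A : Matrix ι ι ℂ) (r : ℝ) : IsStarProjection (projGT A r) where
  isIdempotentElem := by
    rw [IsIdempotentElem, projGT, cfc_mul_cfc]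
    congr! 2 with t
    split_ifs <;> simp
  isSelfAdjoint := cfc_predicate _ A

theorem isSelfAdjoint_invSqrt (A : Matrix ι ι ℂ) : IsSelfAdjoint (invSqrt A) :=
  cfc_predicate _ A

theorem sqrt_mul_inv_sqrt (t : ℝ) : √t * (√t)⁻¹ = if 0 < t then 1 else 0 := by
  split_ifs with ht
  · exact mul_inv_cancel₀ (Real.sqrt_pos.2 ht).ne'
  · rw [Real.sqrt_eq_zero_of_nonpos (not_lt.1 ht), zero_mul]

theorem cfc_sqrt_mul_invSqrt (A : Matrix ι ι ℂ) : cfc Real.sqrt A * invSqrt A = projGT A 0 := by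
  simp only [invSqrt, projGT, cfc_mul_cfc, sqrt_mul_inv_sqrt]

theorem invSqrt_mul_cfc_sqrt (A : Matrix ι ι ℂ) : invSqrt A * cfc Real.sqrt A = projGT A 0 := by
  simp only [invSqrt, projGT, cfc_mul_cfc, mul_comm (_)⁻¹, sqrt_mul_inv_sqrt]

theorem cfc_sqrt_mul_cfc_sqrt {A : Matrix ι ι ℂ} (hA : 0 ≤ A) :
    cfc Real.sqrt A * cfc Real.sqrt A = A := by
  rw [← cfcₙ_eq_cfc, ← CFC.sqrt_eq_real_sqrt A, CFC.sqrt_mul_sqrt_self A]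

theorem cfc_sqrt_mul_projGT (A : Matrix ι ι ℂ) :
    cfc Real.sqrt A * projGT A 0 = cfc Real.sqrt A := by
  rw [projGT, cfc_mul_cfc]
  congr! 2 with t
  split_ifs with ht
  · rw [mul_one]
  · rw [Real.sqrt_eq_zero_of_nonpos (not_lt.1 ht), zero_mul]

theorem invSqrt_mul_projGT (A : Matrix ι ι ℂ) : invSqrt A * projGT A 0 = invSqrt A := by
  rw [← invSqrt_mul_cfc_sqrt, invSqrt, cfc_mul_cfc, cfc_mul_cfc]
  congr! 2 with t
  simpa only [inv_inv, mul_comm] using mul_inv_mul_cancel (√t)⁻¹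

theorem invSqrt_mul_self_mul_invSqrt {A : Matrix ι ι ℂ} (hA : 0 ≤ A) :
    invSqrt A * A * invSqrt A = projGT A 0 := by
  nth_rw 2 [← cfc_sqrt_mul_cfc_sqrt hA]
  rw [← mul_assoc, mul_assoc, invSqrt_mul_cfc_sqrt, cfc_sqrt_mul_invSqrt,
    (isStarProjection_projGT A 0).isIdempotentElem.eq]

theorem eq_zero_of_projGT_eq_zero {A : Matrix ι ι ℂ} (hA : 0 ≤ A) (h : projGT A 0 = 0) :
    A = 0 := by
  rw [← cfc_sqrt_mul_cfc_sqrt hA, ← cfc_sqrt_mul_projGT, h, mul_zero, zero_mul]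

theorem smul_invSqrt_mul_invSqrt_le_one {A : Matrix ι ι ℂ} (hA : 0 ≤ A) {c : ℝ}
    (hcA : c • projGT A 0 ≤ A) : c • (invSqrt A * invSqrt A) ≤ 1 := by
  have h := (isSelfAdjoint_invSqrt A).conjugate_le_conjugate hcA
  rw [mul_smul_comm, smul_mul_assoc, invSqrt_mul_projGT, invSqrt_mul_self_mul_invSqrt hA] at h
  exact h.trans (isStarProjection_projGT A 0).le_one

end InverseSquareRoot

section Average

variable {ι X : Type*} [Fintype X]

theorem avg_nonneg {p : X → ℝ} (hp : ∀ y, 0 ≤ p y) {E : X → Matrix ι ι ℂ} (hE : ∀ y, 0 ≤ E y) :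
    0 ≤ avg p E :=
  Finset.sum_nonneg fun y _ => real_smul_nonneg (hp y) (hE y)

theorem mul_avg_mul [Fintype ι] (p : X → ℝ) (E : X → Matrix ι ι ℂ) (C D : Matrix ι ι ℂ) :
    C * avg p E * D = avg p fun y => C * E y * D := by
  simp only [avg, Finset.mul_sum, Finset.sum_mul, mul_smul_comm, smul_mul_assoc]

end Average

section CostMatrix

variable {ι X : Type*} [Fintype ι] [DecidableEq ι]

theorem le_lambdaMax_smul_one {A : Matrix ι ι ℂ} (hA : IsSelfAdjoint A) :
    A ≤ lambdaMax A • (1 : Matrix ι ι ℂ) :=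
  (le_real_smul_one_iff hA).2 fun _ ht => le_csSup A.finite_real_spectrum.bddAbove ht

theorem lambdaMax_le {A : Matrix ι ι ℂ} (hA : IsSelfAdjoint A) {r : ℝ} (hr : 0 ≤ r)
    (h : A ≤ r • (1 : Matrix ι ι ℂ)) : lambdaMax A ≤ r :=
  Real.sSup_le ((le_real_smul_one_iff hA).1 h) hr

variable {A : Matrix ι ι ℂ} {F : X → Matrix ι ι ℂ}

theorem invSqrt_conj_le_iSup_smul_one [Finite X] (hF : ∀ y, IsSelfAdjoint (F y)) (y : X) :
    invSqrt A * F y * invSqrt A ≤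
      (⨆ y, lambdaMax (invSqrt A * F y * invSqrt A)) • (1 : Matrix ι ι ℂ) :=
  (le_lambdaMax_smul_one ((hF y).conjugate_self (isSelfAdjoint_invSqrt A))).trans <|
    smul_le_smul_of_nonneg_right
      (le_ciSup (f := fun y => lambdaMax (invSqrt A * F y * invSqrt A))
        (Set.finite_range _).bddAbove y) zero_le_one

theorem costMatrix_nonneg (hF : ∀ y, 0 ≤ F y) (y : X) : 0 ≤ costMatrix A F y :=
  smul_nonneg (Real.exp_pos _).le ((isSelfAdjoint_invSqrt A).conjugate_nonneg (hF y))

theorem pinch_costMatrix (y : X) : pinch (projGT A 0) (costMatrix A F y) = costMatrix A F y := by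
  have hproj : projGT A 0 * invSqrt A = invSqrt A := by
    have h := congrArg star (invSqrt_mul_projGT A)
    rwa [star_mul, (isSelfAdjoint_invSqrt A).star_eq,
      (isStarProjection_projGT A 0).isSelfAdjoint.star_eq] at h
  rw [pinch, costMatrix, mul_smul_comm, smul_mul_assoc, mul_assoc (invSqrt A), ← mul_assoc, hproj,
    mul_assoc, mul_assoc, invSqrt_mul_projGT]

theorem costMatrix_le_projGT [Finite X] (hF : ∀ y, IsSelfAdjoint (F y)) (y : X) :
    costMatrix A F y ≤ projGT A 0 := by
  have hle_one : costMatrix A F y ≤ 1 := by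
    have hle : invSqrt A * F y * invSqrt A ≤ Real.exp (dMax A F) • (1 : Matrix ι ι ℂ) :=
      (invSqrt_conj_le_iSup_smul_one hF y).trans
        (smul_le_smul_of_nonneg_right (Real.le_exp_log _) zero_le_one)
    have h := smul_le_smul_of_nonneg_left hle (Real.exp_pos (-dMax A F)).le
    rwa [smul_smul, ← Real.exp_add, neg_add_cancel, Real.exp_zero, one_smul] at h
  have hproj := isStarProjection_projGT A 0
  have h := hproj.isSelfAdjoint.conjugate_le_conjugate hle_one
  rwa [mul_one, hproj.isIdempotentElem.eq, ← pinch, pinch_costMatrix] at h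

theorem avg_costMatrix [Fintype X] (p : X → ℝ) :
    avg p (costMatrix A F) = Real.exp (-dMax A F) • (invSqrt A * avg p F * invSqrt A) := by
  rw [mul_avg_mul]
  simp only [avg, costMatrix, Finset.smul_sum, smul_comm (p _)]

theorem cfc_sqrt_mul_costMatrix_mul_cfc_sqrt {y : X} (hF : pinch (projGT A 0) (F y) = F y) :
    cfc Real.sqrt A * costMatrix A F y * cfc Real.sqrt A = Real.exp (-dMax A F) • F y := by
  have h : cfc Real.sqrt A * (invSqrt A * F y * invSqrt A) * cfc Real.sqrt A = F y := by
    simp only [mul_assoc, invSqrt_mul_cfc_sqrt]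
    rw [← mul_assoc, cfc_sqrt_mul_invSqrt, ← mul_assoc, ← pinch, hF]
  rw [costMatrix, mul_smul_comm, smul_mul_assoc, h]

theorem iSup_lambdaMax_pos [Fintype X] {p : X → ℝ} (hp : ∀ y, 0 ≤ p y) (hF : ∀ y, 0 ≤ F y)
    (hA : avg p F ≠ 0) : 0 < ⨆ y, lambdaMax (invSqrt (avg p F) * F y * invSqrt (avg p F)) := by
  have hA_nonneg := avg_nonneg hp hF
  by_contra! hle
  have hzero (y : X) : invSqrt (avg p F) * F y * invSqrt (avg p F) = 0 :=
    le_antisymm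
      ((invSqrt_conj_le_iSup_smul_one (fun y => .of_nonneg (hF y)) y).trans
        (smul_nonpos_of_nonpos_of_nonneg hle zero_le_one))
      ((isSelfAdjoint_invSqrt _).conjugate_nonneg (hF y))
  refine hA (eq_zero_of_projGT_eq_zero hA_nonneg ?_)
  rw [← invSqrt_mul_self_mul_invSqrt hA_nonneg, mul_avg_mul]
  simp only [hzero]
  simp only [avg, smul_zero, Finset.sum_const_zero]

theorem exp_dMax_le [Fintype X] {p : X → ℝ} (hp : ∀ y, 0 ≤ p y) (hF : ∀ y, 0 ≤ F y)
    (hA : avg p F ≠ 0) {η c : ℝ} (hη : 0 ≤ η) (hFη : ∀ y, F y ≤ η • (1 : Matrix ι ι ℂ))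
    (hc : 0 < c) (hcA : c • projGT (avg p F) 0 ≤ avg p F) :
    Real.exp (dMax (avg p F) F) ≤ η / c := by
  set N := invSqrt (avg p F)
  have hN : IsSelfAdjoint N := isSelfAdjoint_invSqrt _
  have hle (y : X) : N * F y * N ≤ (η / c) • (1 : Matrix ι ι ℂ) := by
    calc N * F y * N ≤ N * (η • 1) * N := hN.conjugate_le_conjugate (hFη y)
      _ = (η / c) • (c • (N * N)) := by
        rw [mul_smul_comm, mul_one, smul_mul_assoc, smul_smul, div_mul_cancel₀ _ hc.ne']
      _ ≤ (η / c) • 1 := smul_le_smul_of_nonneg_left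
        (smul_invSqrt_mul_invSqrt_le_one (avg_nonneg hp hF) hcA) (by positivity)
  rw [dMax, Real.exp_log (iSup_lambdaMax_pos hp hF hA)]
  exact Real.iSup_le (fun y => lambdaMax_le ((IsSelfAdjoint.of_nonneg (hF y)).conjugate_self hN)
    (by positivity) (hle y)) (by positivity)

theorem IsMMWURun.smul_avg_le_codebookAvg [Fintype X] {p : X → ℝ} (hp : p ∈ stdSimplex ℝ X)
    (hF : ∀ y, 0 ≤ F y) (hFP : ∀ y, pinch (projGT (avg p F) 0) (F y) = F y) {ε : ℝ} (hε : 0 < ε)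
    {L : ℕ} (hL_pos : 0 < L)
    (hL : Real.exp (dMax (avg p F) F) * Real.log (projGT (avg p F) 0).trace.re ≤ ε ^ 2 * L)
    {x : Fin L → X} (hx : IsMMWURun (projGT (avg p F) 0) ε (costMatrix (avg p F) F) x) :
    (1 - 2 * ε) • avg p F ≤ codebookAvg F x := by
  set A := avg p F with hA
  have hA_nonneg : 0 ≤ A := avg_nonneg hp.1 hF
  have hL' : Real.log (projGT A 0).trace.re ≤ ε ^ 2 * (L * Real.exp (-dMax A F)) := by
    rwa [← mul_assoc, Real.exp_neg, ← div_eq_mul_inv, le_div_iff₀' (Real.exp_pos _)]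
  have hregret : ((1 - 2 * ε) * (L * Real.exp (-dMax A F))) • projGT A 0 ≤
      ∑ l, costMatrix A F (x l) := by
    refine hx.smul_le_sum hp (isStarProjection_projGT A 0) (costMatrix_nonneg hF)
      (costMatrix_le_projGT fun y => .of_nonneg (hF y)) hε (Real.exp_pos _).le ?_ hL'
    rw [avg_costMatrix, ← hA, invSqrt_mul_self_mul_invSqrt hA_nonneg]
  have hconj : ((1 - 2 * ε) * (L * Real.exp (-dMax A F))) • A ≤
      Real.exp (-dMax A F) • ∑ l, F (x l) := by
    have hR : IsSelfAdjoint (cfc Real.sqrt A) := cfc_predicate _ A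
    have h := hR.conjugate_le_conjugate hregret
    simpa only [mul_smul_comm, smul_mul_assoc, cfc_sqrt_mul_projGT,
      cfc_sqrt_mul_cfc_sqrt hA_nonneg, Finset.mul_sum, Finset.sum_mul,
      cfc_sqrt_mul_costMatrix_mul_cfc_sqrt (hFP _), ← Finset.smul_sum] using h
  have hscale : 0 ≤ Real.exp (dMax A F) / L := by positivity
  calc (1 - 2 * ε) • A
      = (Real.exp (dMax A F) / L) • ((1 - 2 * ε) * (L * Real.exp (-dMax A F))) • A := by
        rw [smul_smul, Real.exp_neg]
        congr 1
        field_simp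
    _ ≤ (Real.exp (dMax A F) / L) • Real.exp (-dMax A F) • ∑ l, F (x l) :=
        smul_le_smul_of_nonneg_left hconj hscale
    _ = codebookAvg F x := by
        rw [codebookAvg, smul_smul, Real.exp_neg]
        congr 1
        field_simp

end CostMatrix

section Truncation

variable {ι : Type*} [Fintype ι] [DecidableEq ι]

theorem commute_projGT {ρ : Matrix ι ι ℂ} (hρ : IsSelfAdjoint ρ) (r : ℝ) :
    Commute (projGT ρ r) ρ := by
  have h := cfc_commute_cfc (fun t : ℝ => if r < t then (1 : ℝ) else 0) id ρ
  rwa [cfc_id ℝ ρ hρ] at h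

theorem pinch_projGT {ρ : Matrix ι ι ℂ} (hρ : IsSelfAdjoint ρ) (r : ℝ) :
    pinch (projGT ρ r) ρ = cfc (fun t : ℝ => if r < t then t else 0) ρ := by
  nth_rw 2 [← cfc_id' ℝ ρ hρ]
  rw [pinch, projGT, cfc_mul_cfc, cfc_mul_cfc]
  congr! 2 with t
  split_ifs <;> simp

theorem projGT_pinch_projGT {ρ : Matrix ι ι ℂ} (hρ : IsSelfAdjoint ρ) {r : ℝ} (hr : 0 ≤ r) :
    projGT (pinch (projGT ρ r) ρ) 0 = projGT ρ r := by
  rw [pinch_projGT hρ, projGT, ← cfc_comp' _ _ ρ (Set.Finite.continuousOn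
    (ρ.finite_real_spectrum.image _) _) (continuousOn_spectrum _ ρ) hρ, projGT]
  congr! 2 with t
  by_cases h : r < t
  · simp [h, hr.trans_lt h]
  · simp [h]

theorem smul_projGT_le_pinch {ρ : Matrix ι ι ℂ} (hρ : IsSelfAdjoint ρ) (r : ℝ) :
    r • projGT ρ r ≤ pinch (projGT ρ r) ρ := by
  rw [pinch_projGT hρ, projGT, ← cfc_const_mul r _ ρ (continuousOn_spectrum _ ρ)]
  refine cfc_mono (fun t _ => ?_) (continuousOn_spectrum _ ρ) (continuousOn_spectrum _ ρ)
  split_ifs with h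
  · simpa only [mul_one] using h.le
  · rw [mul_zero]

theorem re_trace_sub_pinch_projGT_le {ρ : Matrix ι ι ℂ} (hρ : IsSelfAdjoint ρ) {r : ℝ}
    (hr : 0 ≤ r) :
    ρ.trace.re - (pinch (projGT ρ r) ρ).trace.re ≤ r * Fintype.card ι := by
  have hle : ρ - pinch (projGT ρ r) ρ ≤ r • (1 : Matrix ι ι ℂ) := by
    have hcfc : ρ - pinch (projGT ρ r) ρ = cfc (fun t : ℝ => t - if r < t then t else 0) ρ := by
      rw [pinch_projGT hρ, cfc_sub _ _ ρ (continuousOn_spectrum _ ρ) (continuousOn_spectrum _ ρ),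
        cfc_id' ℝ ρ hρ]
    rw [hcfc, ← Algebra.algebraMap_eq_smul_one]
    refine cfc_le_algebraMap _ _ ρ (fun t _ => ?_) (continuousOn_spectrum _ ρ) hρ
    split_ifs with h
    · simpa only [sub_self] using hr
    · simpa only [sub_zero] using not_lt.1 h
  simpa [re_trace_real_smul] using re_trace_mono hle

end Truncation

section Codebook

variable {ι X : Type*}

theorem codebookAvg_nonneg {L : ℕ} {E : X → Matrix ι ι ℂ} (hE : ∀ y, 0 ≤ E y) (x : Fin L → X) :
    0 ≤ codebookAvg E x :=
  real_smul_nonneg (by positivity) (Finset.sum_nonneg fun _ _ => hE _)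

variable [Fintype ι]

theorem re_trace_avg_le_one [Fintype X] {p : X → ℝ} (hp : p ∈ stdSimplex ℝ X)
    {E : X → Matrix ι ι ℂ} (hE : ∀ y, (E y).trace.re ≤ 1) : (avg p E).trace.re ≤ 1 := by
  classical
  have h := re_trace_mul_avg_le (G := 1) (M := E) (r := 1) hp (by simpa only [one_mul] using hE)
  simpa only [one_mul] using h

theorem re_trace_codebookAvg_le_one {L : ℕ} {E : X → Matrix ι ι ℂ}
    (hE : ∀ y, (E y).trace.re ≤ 1) (x : Fin L → X) : (codebookAvg E x).trace.re ≤ 1 := by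
  rw [codebookAvg, re_trace_real_smul, Matrix.trace_sum, Complex.re_sum, one_div_mul_eq_div]
  refine div_le_one_of_le₀ ?_ (Nat.cast_nonneg L)
  simpa using Finset.sum_le_sum fun l (_ : l ∈ Finset.univ) => hE (x l)

theorem pinch_codebookAvg {L : ℕ} (P : Matrix ι ι ℂ) (E : X → Matrix ι ι ℂ) (x : Fin L → X) :
    pinch P (codebookAvg E x) = codebookAvg (fun y => pinch P (E y)) x := by
  simp only [pinch, codebookAvg, mul_smul_comm, smul_mul_assoc, Finset.mul_sum, Finset.sum_mul]

theorem log_re_trace_le {P : Matrix ι ι ℂ} (hP : IsStarProjection P) :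
    Real.log P.trace.re ≤ Real.log (Fintype.card ι) := by
  classical
  have hcard : P.trace.re ≤ Fintype.card ι := by simpa using re_trace_mono hP.le_one
  rcases (re_trace_nonneg hP.nonneg).eq_or_lt with h0 | hpos
  · simpa only [← h0, Real.log_zero] using Real.log_natCast_nonneg _
  · exact Real.log_le_log hpos hcard

variable [DecidableEq ι]

theorem IsMMWUCodebook.smul_pinch_le_pinch [Fintype X] {p : X → ℝ} {E : X → Matrix ι ι ℂ}
    {ε τ₀ η : ℝ} {L : ℕ} {x : Fin L → X} (hx : IsMMWUCodebook p E ε τ₀ x)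
    (hp : p ∈ stdSimplex ℝ X) (hε : 0 < ε) (hτ₀ : 0 < τ₀) (hη : 0 ≤ η) (hE : ∀ y, 0 ≤ E y)
    (hEη : ∀ y, E y ≤ η • (1 : Matrix ι ι ℂ)) (hL_pos : 0 < L)
    (hL : η * Fintype.card ι * Real.log (Fintype.card ι) / (ε ^ 2 * τ₀) ≤ L) :
    (1 - 2 * ε) • pinch (largeProj p E τ₀) (avg p E) ≤
      pinch (largeProj p E τ₀) (codebookAvg E x) := by
  set P := largeProj p E τ₀ with hP_def
  set F : X → Matrix ι ι ℂ := fun y => pinch P (E y)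
  have hρ : IsSelfAdjoint (avg p E) := .of_nonneg (avg_nonneg hp.1 hE)
  have hP : IsStarProjection P := isStarProjection_projGT _ _
  have hF (y : X) : 0 ≤ F y := pinch_nonneg hP.isSelfAdjoint (hE y)
  have havg : pinch P (avg p E) = avg p F := mul_avg_mul p E P P
  rw [pinch_codebookAvg, havg]
  rcases eq_or_ne (avg p F) 0 with hA | hA
  · rw [hA, smul_zero]
    exact codebookAvg_nonneg hF x
  cases isEmpty_or_nonempty ι
  · exact absurd (Subsingleton.elim _ _) hA
  have hr : 0 < τ₀ / Fintype.card ι := by positivity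
  have hproj : projGT (avg p F) 0 = P := by
    rw [← havg]
    exact projGT_pinch_projGT hρ hr.le
  have hFη (y : X) : F y ≤ η • (1 : Matrix ι ι ℂ) := pinch_le_smul_one hP hη (hEη y)
  have hPA : (τ₀ / Fintype.card ι) • projGT (avg p F) 0 ≤ avg p F := by
    rw [hproj, ← havg]
    exact smul_projGT_le_pinch hρ _
  have hrun : IsMMWURun (projGT (avg p F) 0) ε (costMatrix (avg p F) F) x := havg ▸ hx
  refine hrun.smul_avg_le_codebookAvg hp hF
    (fun y => by rw [hproj, pinch_pinch hP.isIdempotentElem]) hε hL_pos ?_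
  calc Real.exp (dMax (avg p F) F) * Real.log (projGT (avg p F) 0).trace.re
      ≤ Real.exp (dMax (avg p F) F) * Real.log (Fintype.card ι) :=
        mul_le_mul_of_nonneg_left (log_re_trace_le (isStarProjection_projGT _ _))
          (Real.exp_pos _).le
    _ ≤ η / (τ₀ / Fintype.card ι) * Real.log (Fintype.card ι) :=
        mul_le_mul_of_nonneg_right (exp_dMax_le hp.1 hF hA hη hFη hr hPA)
          (Real.log_natCast_nonneg _)
    _ ≤ ε ^ 2 * L := by
      rw [div_le_iff₀ (by positivity)] at hL
      rw [div_div_eq_mul_div, div_mul_eq_mul_div, div_le_iff₀ hτ₀]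
      linarith

end Codebook

end SoftCovering

open scoped MatrixOrder in
theorem mainTheorem1_general {ι X : Type*} [Fintype ι] [DecidableEq ι] [Fintype X]
    (p : X → ℝ) (hp : p ∈ stdSimplex ℝ X)
    (E : X → Matrix ι ι ℂ) (ε τ τ₀ η : ℝ) (hε : 0 < ε) (hτ₀ : 0 < τ₀) (hη : 0 ≤ η)
    (hE : ∀ x, 0 ≤ E x) (hE_trace : ∀ x, (E x).trace.re ≤ 1)
    (hE_le : ∀ x, E x ≤ η • (1 : Matrix ι ι ℂ)) (hEp : 1 - τ ≤ (avg p E).trace.re)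
    (L : ℕ) (hL_pos : 0 < L)
    (hL : η * Fintype.card ι * Real.log (Fintype.card ι) / (ε ^ 2 * τ₀) ≤ L) :
    (∃ x : Fin L → X, IsMMWUCodebook p E ε τ₀ x) ∧
      ∀ x : Fin L → X, IsMMWUCodebook p E ε τ₀ x →
        traceDist (avg p E) (codebookAvg E x) ≤
          2 * ε + τ / 2 + τ₀ + Real.sqrt (2 * ε + τ + τ₀) := by
  have : Nonempty X := by
    by_contra hX
    rw [not_nonempty_iff] at hX
    simpa using hp.2
  refine ⟨exists_isMMWURun L _ ε _, fun x hx => ?_⟩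
  have hρ := avg_nonneg hp.1 hE
  have hP : IsStarProjection (largeProj p E τ₀) := isStarProjection_projGT _ _
  have htruncation : (avg p E).trace.re - (pinch (largeProj p E τ₀) (avg p E)).trace.re ≤ τ₀ :=
    (re_trace_sub_pinch_projGT_le (.of_nonneg hρ) (by positivity)).trans
      (by rw [div_mul_comm]; exact mul_le_of_le_one_left hτ₀.le (div_self_le_one _))
  have hnorm := traceNorm_sub_le_of_le_pinch hP hρ (codebookAvg_nonneg hE x)
    (re_trace_avg_le_one hp hE_trace) (re_trace_codebookAvg_le_one hE_trace x) hε.le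
    (pinch_le_of_commute hP hρ (commute_projGT (.of_nonneg hρ) _)) hEp htruncation
    (hx.smul_pinch_le_pinch hp hε hτ₀ hη hE hE_le hL_pos hL)
  rw [traceDist]
  linarith

theorem mainTheorem1 {ι X : Type*} [Fintype ι] [DecidableEq ι] [Fintype X]
    (p : X → ℝ) (hp : p ∈ stdSimplex ℝ X)
    (E : X → Matrix ι ι ℂ) (ε τ τ₀ η : ℝ)
    (hε : ε ∈ Set.Ioo (0 : ℝ) (1 / 2)) (hτ : τ ∈ Set.Ioo (0 : ℝ) (1 / 2))
    (hτ₀ : τ₀ ∈ Set.Ioo (0 : ℝ) (1 / 2 - τ)) (hη : 0 < η)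
    (hE : ∀ x, (E x).PosSemidef)
    (hE_trace : ∀ x, (E x).trace.re ≤ 1)
    (hE_le : ∀ x, (η • (1 : Matrix ι ι ℂ) - E x).PosSemidef)
    (hEp : 1 - τ ≤ (avg p E).trace.re)
    (L : ℕ) (hL_pos : 0 < L)
    (hL : η * Fintype.card ι * Real.log (Fintype.card ι) / (ε ^ 2 * τ₀) ≤ L) :
    (∃ x : Fin L → X, IsMMWUCodebook p E ε τ₀ x) ∧
      ∀ x : Fin L → X, IsMMWUCodebook p E ε τ₀ x →
        traceDist (avg p E) (codebookAvg E x) ≤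
          3 * ε + 3 * τ + 7 / 2 * τ₀ + Real.sqrt (2 * ε + τ + τ₀) := by
  obtain ⟨hexists, hbound⟩ := mainTheorem1_general p hp E ε τ τ₀ η hε.1 hτ₀.1 hη.le
    (fun x => Matrix.nonneg_iff_posSemidef.2 (hE x)) hE_trace
    (fun x => Matrix.le_iff.2 (hE_le x)) hEp L hL_pos hL
  exact ⟨hexists, fun x hx => (hbound x hx).trans (by linarith [hε.1, hτ.1, hτ₀.1])⟩
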